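/- Let $c_1,c_2,\dots$ be indeterminates, let $$u(t)=t+\sum_{n=1}^{\infty}c_n\frac{t^{n+1}}{n+1}\in\mathbf{Q}[c_1,c_2,\dots][[t]],$$ and let $t(u)$ be its inverse power series under composition. Define the universal Bernoulli numbers $\hat B_n\in\mathbf{Q}[c_1,c_2,\dots]$ by $$\frac{u}{t(u)}=\sum_{n=0}^{\infty}\hat B_n\frac{u^n}{n!}.$$ (Adelberg's congruence relation) Let $p$ be a prime number, and let $n$ and $a$ be positive integers. If $n\not\equiv 0,1 \bmod (p-1)$ and $n>a$, then $$c_{p-1}^{\,p^{a-1}}\cdot\frac{\hat B_n}{n}\equiv\frac{\hat B_{n+p^{a-1}(p-1)}}{n+p^{a-1}(p-1)} \mod p^a,$$ where the congruence is coefficientwise: every coefficient of the difference of the two sides lies in $p^a\mathbf{Z}_{(p)}$, that is, equals $p^a$ times a rational number whose denominator is prime to $p$. -/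

import Mathlib

namespace UniversalBernoulli

/-- The ring `ℚ[c₁, c₂, …]` of polynomials in countably many indeterminates. -/
abbrev PolyRing : Type := MvPolynomial ℕ+ ℚ

/-- The indeterminate `cₙ` for `n ≥ 1`, together with the normalization `c₀ = 1`. -/
noncomputable def c (n : ℕ) : PolyRing :=
  if h : 0 < n then MvPolynomial.X ⟨n, h⟩ else 1

/-- The power series `u(t) = t + ∑_{n ≥ 1} cₙ t ^ (n + 1) / (n + 1)`
(the leading term is the summand `n = 0`). -/
noncomputable def uSeries : PowerSeries PolyRing :=
  PowerSeries.mk fun k => if k = 0 then 0 else (k : ℚ)⁻¹ • c (k - 1)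

theorem constantCoeff_uSeries : PowerSeries.constantCoeff uSeries = 0 := by
  rw [← PowerSeries.coeff_zero_eq_constantCoeff_apply]
  simp [uSeries]

theorem coeff_one_uSeries : PowerSeries.coeff 1 uSeries = 1 := by
  simp [uSeries, c]

theorem isUnit_coeff_one_uSeries : IsUnit (PowerSeries.coeff 1 uSeries) := by
  rw [coeff_one_uSeries]
  exact isUnit_one

/-- The power series `t(u)`, the inverse of `u(t)` under composition. -/
noncomputable def tSeries : PowerSeries PolyRing :=
  PowerSeries.substInvOfIsUnit uSeries isUnit_coeff_one_uSeries

theorem uSeries_subst_tSeries : uSeries.subst tSeries = PowerSeries.X :=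
  PowerSeries.subst_substInvOfIsUnit_right uSeries constantCoeff_uSeries
    isUnit_coeff_one_uSeries

theorem tSeries_subst_uSeries : tSeries.subst uSeries = PowerSeries.X :=
  PowerSeries.subst_substInvOfIsUnit_left uSeries constantCoeff_uSeries
    isUnit_coeff_one_uSeries

theorem coeff_one_tSeries : PowerSeries.coeff 1 tSeries = 1 := by
  simp [tSeries, coeff_one_uSeries]

/-- The power series `t(u) / u`, whose constant term is `1`. -/
noncomputable def tSeriesDivX : PowerSeries PolyRing :=
  PowerSeries.mk fun k => PowerSeries.coeff (k + 1) tSeries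

theorem tSeries_eq : tSeries = PowerSeries.X * tSeriesDivX := by
  ext k
  cases k with
  | zero => simp [tSeries]
  | succ k => simp [tSeriesDivX, PowerSeries.coeff_succ_X_mul]

/-- The power series `u / t(u)`. -/
noncomputable def quotSeries : PowerSeries PolyRing :=
  PowerSeries.invOfUnit tSeriesDivX 1

theorem quotSeries_mul_tSeries : quotSeries * tSeries = PowerSeries.X := by
  have h : tSeriesDivX * quotSeries = 1 := by
    refine PowerSeries.mul_invOfUnit _ _ ?_
    rw [← PowerSeries.coeff_zero_eq_constantCoeff_apply]
    simp [tSeriesDivX, coeff_one_tSeries]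
  rw [tSeries_eq, mul_left_comm, mul_comm quotSeries, h, mul_one]

/-- The universal Bernoulli number `B̂ₙ ∈ ℚ[c₁, c₂, …]`, defined by
`u / t(u) = ∑ₙ B̂ₙ uⁿ / n!`. -/
noncomputable def bernoulliHat (n : ℕ) : PolyRing :=
  (n.factorial : ℚ) • PowerSeries.coeff n quotSeries

/-- Congruence of polynomials modulo `p ^ d`, coefficient by coefficient: each coefficient of
`f - g` is `p ^ d` times a rational number whose denominator is prime to `p`. -/
def CongrModPow (p d : ℕ) (f g : PolyRing) : Prop :=
  ∀ m : ℕ+ →₀ ℕ, ∃ r : ℚ, ¬ p ∣ r.den ∧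
    MvPolynomial.coeff m f - MvPolynomial.coeff m g = (p : ℚ) ^ d * r

end UniversalBernoulli

/-! Everything rests on a closed formula, `coeff_inv_smul_bernoulliHat`. Put φ = u(t)/t. The
defining series satisfies B(u(t)) = φ, so Lagrange inversion expresses its coefficients through
powers of 1/φ. For a monomial m = ∏ cᵢ^(mᵢ) of weight n = ∑ i·mᵢ and degree d, the coefficient of
B̂ₙ/n is -(-1)^d (n+d-2)! / ∏ (i+1)^(mᵢ) mᵢ!.

Let k be the exponent of c_(p-1), and let P be the product ∏ (i+1)^(mᵢ) mᵢ! over the other indices,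
with valuation v. Since n+d = ∑ (i+1)mᵢ = pk + R + 2, the factor p^k·k! cancels from (pk+R)!. With q
= ⌊R/p⌋, what remains is F(k)/P up to sign, where F(k) = p^q · (k+1)⋯(k+q) · (part of (pk+R)! prime
to p).

Multiplying by c_(p-1)^(p^(a-1)) replaces k by k + p^(a-1), fixes R and P, and flips the sign (-1)^d
because p is odd. So for monomials divisible by this power the claim is p^(v+a) ∣ F(k) +
F(k+p^(a-1)): the prime-to-p part changes sign mod p^a by Wilson's theorem, the rising product is
unchanged mod p^(a-1), and the missing p comes from v + 1 ≤ q (`cycleVal_add_one_le`), or else q = v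
= 0.

The other monomials, with k < p^(a-1), need p^(v+a) ∣ F(k). If the rising product reaches p^(a-1),
the same bound v + 1 ≤ q suffices; otherwise v + n ≤ q + v_p(q!) + 1 (`cycleVal_add_le`) together
with a < n does. The excluded residues of n mod p-1 rule out exactly the extremal configurations in
these bounds. -/

namespace UniversalBernoulli

/-! ### Valuation estimates for ∏ x^u·u! -/

/-- The `p`-adic valuation of `∏ i ∈ s, x i ^ u i * (u i)!`. -/
def cycleVal {ι : Type*} (p : ℕ) (s : Finset ι) (x u : ι → ℕ) : ℕ :=
  ∑ i ∈ s, (u i * padicValNat p (x i) + padicValNat p (u i).factorial)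

theorem sum_mul_eq_filter {ι : Type*} (p : ℕ) {s : Finset ι} {x u : ι → ℕ} :
    ∑ i ∈ s, x i * u i = ∑ i ∈ s with ¬ p ∣ x i, x i * u i +
      p * ∑ i ∈ s with p ∣ x i, x i / p * u i := by
  rw [← Finset.sum_filter_add_sum_filter_not s (fun i => p ∣ x i), add_comm, Finset.mul_sum]
  congr 1
  refine Finset.sum_congr rfl fun i hi => ?_
  rw [← mul_assoc, Nat.mul_div_cancel' (Finset.mem_filter.1 hi).2]

theorem div_eq_pred_of_add_eq_mul {p R c M : ℕ} (h : R + c = p * M) (hc : 1 ≤ c) (hcp : c ≤ p) :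
    R / p = M - 1 := by
  obtain ⟨m, rfl⟩ : ∃ m, M = m + 1 := Nat.exists_eq_add_one_of_ne_zero (by rintro rfl; omega)
  rw [mul_add] at h
  apply Nat.div_eq_of_lt_le
  · rw [add_tsub_cancel_right, mul_comm]
    omega
  · rw [add_tsub_cancel_right, add_mul, mul_comm]
    omega

theorem padicValNat_add_one_le_of_le {p m t : ℕ} (hp5 : 5 ≤ p) (ht : 1 ≤ t) (hm : m ≤ 2 * t)
    (hm0 : m ≠ 0) : padicValNat p m + 1 ≤ t := by
  have h1 := Nat.le_of_dvd (Nat.pos_of_ne_zero hm0) (pow_padicValNat_dvd (p := p) (n := m))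
  have h2 : ∀ f, 1 ≤ f → 2 * f + 2 ≤ p ^ f := by
    intro f hf
    induction f, hf using Nat.le_induction with
    | base => rw [pow_one]; omega
    | succ f hf ih =>
      rw [pow_succ]
      nlinarith
  rcases Nat.eq_zero_or_pos (padicValNat p m) with h | h
  · omega
  · have := h2 _ h
    omega

section Valuation

variable {ι : Type*} {p : ℕ} [hp : Fact p.Prime] {s : Finset ι} {x u : ι → ℕ}

theorem padicValNat_le_of_dvd {a b : ℕ} (hb : b ≠ 0) (h : a ∣ b) :
    padicValNat p a ≤ padicValNat p b :=
  (padicValNat_dvd_iff_le hb).1 (pow_padicValNat_dvd.trans h)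

theorem padicValNat_factorial_mono {a b : ℕ} (h : a ≤ b) :
    padicValNat p a.factorial ≤ padicValNat p b.factorial :=
  padicValNat_le_of_dvd b.factorial_ne_zero (Nat.factorial_dvd_factorial h)

theorem padicValNat_factorial_add_le (a b : ℕ) :
    padicValNat p a.factorial + padicValNat p b.factorial ≤ padicValNat p (a + b).factorial := by
  rw [← padicValNat.mul a.factorial_ne_zero b.factorial_ne_zero]
  exact padicValNat_le_of_dvd (Nat.factorial_ne_zero _)
    (Nat.factorial_mul_factorial_dvd_factorial_add a b)

theorem padicValNat_factorial_eq_div (n : ℕ) :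
    padicValNat p n.factorial = n / p + padicValNat p (n / p).factorial := by
  rw [← padicValNat_mul_div_factorial n, padicValNat_factorial_mul, add_comm]

theorem pow_mul_factorial_dvd_factorial_mul {x : ℕ} (hx : 0 < x) (u : ℕ) :
    x ^ u * u.factorial ∣ (x * u).factorial := by
  induction u with
  | zero => simp
  | succ u ih =>
    obtain ⟨y, rfl⟩ : ∃ y, x = y + 1 := ⟨x - 1, by omega⟩
    have h : (y + 1) * (u + 1) = ((y + 1) * u + y) + 1 := by ring
    rw [pow_succ, Nat.factorial_succ u, h, Nat.factorial_succ, ← h]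
    have := ih.trans (Nat.factorial_dvd_factorial (Nat.le_add_right ((y + 1) * u) y))
    calc _ = (y + 1) * (u + 1) * ((y + 1) ^ u * u.factorial) := by ring
      _ ∣ _ := Nat.mul_dvd_mul_left _ this

theorem padicValNat_pow_mul_factorial {x : ℕ} (hx : 0 < x) (u : ℕ) :
    padicValNat p (x ^ u * u.factorial) = u * padicValNat p x + padicValNat p u.factorial := by
  rw [padicValNat.mul (pow_pos hx u).ne' u.factorial_ne_zero, padicValNat.pow]

/-- The product ∏ x^u·u! is the order of the centralizer of a permutation with u cycles of each
length x, so it divides (∑ x·u)!. -/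
theorem cycleVal_le (hx : ∀ i ∈ s, 0 < x i) :
    cycleVal p s x u ≤ padicValNat p (∑ i ∈ s, x i * u i).factorial := by
  classical
  unfold cycleVal
  induction s using Finset.induction_on with
  | empty => simp
  | insert i s hi ih =>
    rw [Finset.sum_insert hi, Finset.sum_insert hi]
    have h1 := ih fun j hj => hx j (Finset.mem_insert_of_mem hj)
    have hxi := hx i (Finset.mem_insert_self i s)
    have h2 : u i * padicValNat p (x i) + padicValNat p (u i).factorial ≤
        padicValNat p (x i * u i).factorial := by
      rw [← padicValNat_pow_mul_factorial hxi]
      exact padicValNat_le_of_dvd (Nat.factorial_ne_zero _)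
        (pow_mul_factorial_dvd_factorial_mul hxi _)
    exact (add_le_add h2 h1).trans (padicValNat_factorial_add_le _ _)

theorem sum_padicValNat_factorial_le :
    ∑ i ∈ s, padicValNat p (u i).factorial ≤ padicValNat p (∑ i ∈ s, u i).factorial := by
  simpa [cycleVal] using cycleVal_le (p := p) (s := s) (u := u) (x := fun _ => 1) (by simp)

/-- Removing one factor p from each x divisible by p reduces to the same problem for the quotients
x/p. -/
theorem cycleVal_eq_filter (hx : ∀ i ∈ s, 0 < x i) :
    cycleVal p s x u = ∑ i ∈ s with ¬ p ∣ x i, padicValNat p (u i).factorial +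
      (∑ i ∈ s with p ∣ x i, u i + cycleVal p (s.filter fun i => p ∣ x i) (fun i => x i / p) u) := by
  unfold cycleVal
  rw [← Finset.sum_filter_add_sum_filter_not s (fun i => p ∣ x i), add_comm,
    ← Finset.sum_add_distrib]
  congr 1
  · refine Finset.sum_congr rfl fun i hi => ?_
    rw [padicValNat.eq_zero_of_not_dvd (Finset.mem_filter.1 hi).2]
    simp
  · refine Finset.sum_congr rfl fun i hi => ?_
    obtain ⟨his, y, hy⟩ := Finset.mem_filter.1 hi
    have h0 : y ≠ 0 := by
      rintro rfl
      have := hx i his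
      omega
    simp only [hy]
    rw [Nat.mul_div_cancel_left _ hp.out.pos, padicValNat.mul hp.out.ne_zero h0,
      padicValNat.self hp.out.one_lt]
    ring

theorem two_mul_sub_one_mul_add_two_le (hp5 : 5 ≤ p) {f : ℕ} (hf : 2 ≤ f) :
    2 * (p - 1) * f + 2 ≤ p ^ f := by
  obtain ⟨r, rfl⟩ : ∃ r, p = r + 5 := ⟨p - 5, by omega⟩
  induction f, hf using Nat.le_induction with
  | base => simp only [Nat.add_succ_sub_one]; nlinarith
  | succ f hf ih =>
    simp only [Nat.add_succ_sub_one] at *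
    rw [pow_succ]
    have h := Nat.mul_le_mul_right (r + 5) ih
    nlinarith [Nat.zero_le (r * f), Nat.zero_le (r * r * f)]

theorem two_mul_sub_one_mul_padicValNat_add_two_le (hp5 : 5 ≤ p) {x : ℕ} (hx : 2 ≤ x)
    (hxp : x ≠ p) : 2 * (p - 1) * padicValNat p x + 2 ≤ x := by
  obtain ⟨y, hy⟩ := pow_padicValNat_dvd (p := p) (n := x)
  have hy0 : y ≠ 0 := by rintro rfl; omega
  rcases lt_trichotomy (padicValNat p x) 1 with h | h | h
  · rw [Nat.lt_one_iff.1 h]; omega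
  · rw [h, pow_one] at hy
    rw [h]
    have : 2 ≤ y := by
      by_contra hlt
      obtain rfl : y = 1 := by omega
      omega
    have := Nat.mul_le_mul_left p this
    omega
  · have h1 := two_mul_sub_one_mul_add_two_le hp5 h
    have h2 := Nat.mul_le_mul_left (p ^ padicValNat p x) (Nat.one_le_iff_ne_zero.2 hy0)
    rw [← hy] at h2
    omega

/-- Multiply the bound for a single x by u; the resulting 2u absorbs v_p(u!) by Legendre's strict
inequality (p-1)·v_p(u!) < u. -/
theorem cycleVal_term_le (hp5 : 5 ≤ p) {x u : ℕ} (hx : 2 ≤ x) (hxp : x ≠ p) (hu : u ≠ 0) :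
    2 * (p - 1) * (u * padicValNat p x + padicValNat p u.factorial) + 2 ≤ x * u := by
  have h1 := two_mul_sub_one_mul_padicValNat_add_two_le hp5 hx hxp
  have h2 := sub_one_mul_padicValNat_factorial_lt_of_ne_zero p hu
  have h3 := Nat.mul_le_mul_right u h1
  nlinarith

/-- An upper bound for the `p`-adic valuation of `∏ i, x i ^ u i * (u i)!` when no `x i` is `p`. -/
theorem two_mul_sub_one_mul_cycleVal_le (hp5 : 5 ≤ p) (hx : ∀ i ∈ s, 2 ≤ x i ∧ x i ≠ p) {R : ℕ}
    (hR : ∑ i ∈ s, x i * u i = R + 2) : 2 * (p - 1) * cycleVal p s x u ≤ R := by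
  classical
  obtain ⟨i, hi, hne⟩ : ∃ i ∈ s, u i ≠ 0 := by
    by_contra! h
    rw [Finset.sum_eq_zero fun i hi => by rw [h i hi, mul_zero]] at hR
    omega
  have h1 : 2 * (p - 1) * cycleVal p (s.erase i) x u ≤ ∑ j ∈ s.erase i, x j * u j := by
    unfold cycleVal
    rw [Finset.mul_sum]
    refine Finset.sum_le_sum fun j hj => ?_
    have hjs := hx j (Finset.mem_of_mem_erase hj)
    rcases eq_or_ne (u j) 0 with h | h
    · simp [h]
    · have := cycleVal_term_le hp5 hjs.1 hjs.2 h
      omega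
  have h2 := cycleVal_term_le hp5 (hx i hi).1 (hx i hi).2 hne
  rw [← Finset.add_sum_erase s _ hi] at hR
  have h3 : cycleVal p s x u = (u i * padicValNat p (x i) + padicValNat p (u i).factorial) +
      cycleVal p (s.erase i) x u := by
    unfold cycleVal
    rw [← Finset.add_sum_erase s _ hi]
  rw [h3, mul_add]
  omega

theorem cycleVal_eq_zero (hp5 : 5 ≤ p) (hx : ∀ i ∈ s, 2 ≤ x i ∧ x i ≠ p) {R : ℕ}
    (hR : ∑ i ∈ s, x i * u i = R + 2) (hq : R / p = 0) : cycleVal p s x u = 0 := by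
  have h := two_mul_sub_one_mul_cycleVal_le hp5 hx hR
  rw [Nat.div_eq_zero_iff_lt (by omega)] at hq
  by_contra h0
  have := Nat.mul_le_mul_left (2 * (p - 1)) (Nat.one_le_iff_ne_zero.2 h0)
  omega

theorem sum_eq_single_of_mul_le (hx : ∀ i ∈ s, 2 ≤ x i) {i : ι} (hi : i ∈ s)
    (hle : ∑ j ∈ s, x j * u j ≤ x i * u i + 1) :
    ∑ j ∈ s, x j * u j = x i * u i ∧ ∑ j ∈ s, u j = u i := by
  classical
  have h0 : ∀ j ∈ s, j ≠ i → u j = 0 := by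
    intro j hj hji
    have h1 : x j * u j ≤ ∑ k ∈ s.erase i, x k * u k :=
      Finset.single_le_sum (f := fun k => x k * u k) (fun _ _ => Nat.zero_le _)
        (Finset.mem_erase.2 ⟨hji, hj⟩)
    rw [← Finset.add_sum_erase s _ hi] at hle
    have h2 := Nat.mul_le_mul_right (u j) (hx j hj)
    omega
  constructor
  · exact Finset.sum_eq_single_of_mem i hi fun j hj hji => by rw [h0 j hj hji, mul_zero]
  · exact Finset.sum_eq_single_of_mem i hi fun j hj hji => h0 j hj hji

/-- A failure gives 2(p-1)q ≤ R < p(q+1), hence q = 1 and ∑ x·u is 2p or 2p+1. A term of positive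
valuation is then (x, u) = (2p, 1) or (2, p), and it is the only one. In both cases ∑ x·u ≡ ∑ u + 1
mod p-1, which is excluded. -/
theorem cycleVal_add_one_le (hp5 : 5 ≤ p) (hx : ∀ i ∈ s, 2 ≤ x i ∧ x i ≠ p) {R : ℕ}
    (hR : ∑ i ∈ s, x i * u i = R + 2)
    (h1 : ¬ ∑ i ∈ s, x i * u i ≡ ∑ i ∈ s, u i + 1 [MOD (p - 1)]) (hq : R / p ≠ 0) :
    cycleVal p s x u + 1 ≤ R / p := by
  have h := two_mul_sub_one_mul_cycleVal_le hp5 hx hR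
  have hlt : R < p * (R / p + 1) := Nat.lt_mul_div_succ R hp.out.pos
  generalize R / p = q at *
  by_contra hcon
  have hle := Nat.mul_le_mul_left (2 * (p - 1)) (show q ≤ cycleVal p s x u by omega)
  obtain ⟨r, rfl⟩ : ∃ r, p = r + 5 := ⟨p - 5, by omega⟩
  simp only [Nat.add_succ_sub_one] at *
  have hq1 : q = 1 := by
    by_contra h2
    have : 2 ≤ q := by omega
    nlinarith
  subst hq1
  have hv : cycleVal (r + 5) s x u ≠ 0 := by omega
  apply h1
  unfold cycleVal at hv
  obtain ⟨i, hi, hne⟩ := Finset.exists_ne_zero_of_sum_ne_zero hv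
  have hxi := hx i hi
  have hui : u i ≠ 0 := by
    intro h0
    simp [h0] at hne
  have hterm : x i * u i ≤ R + 2 := by
    rw [← hR]
    exact Finset.single_le_sum (f := fun k => x k * u k) (fun _ _ => Nat.zero_le _) hi
  by_cases hdvd : r + 5 ∣ x i
  · obtain ⟨y, hy⟩ := hdvd
    have hy1 : y ≠ 0 := by rintro rfl; omega
    have hy2 : y ≠ 1 := by rintro rfl; omega
    have hyu : y * u i < 3 := by
      by_contra hge
      have := Nat.mul_le_mul_left (r + 5) (not_lt.1 hge)
      rw [← mul_assoc, ← hy] at this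
      omega
    have hu1 : u i = 1 := by
      by_contra hu1
      have : 2 * 2 ≤ y * u i := Nat.mul_le_mul (by omega) (by omega)
      omega
    rw [hu1] at hyu
    obtain rfl : y = 2 := by omega
    obtain ⟨e1, e2⟩ := sum_eq_single_of_mul_le (fun j hj => (hx j hj).1) hi
      (show _ ≤ x i * u i + 1 by rw [hu1]; omega)
    rw [e1, e2, hu1, hy]
    refine ((Nat.modEq_iff_dvd' (by omega)).2 ⟨2, ?_⟩).symm
    omega
  · have hfac : r + 5 ≤ u i := by
      rw [padicValNat.eq_zero_of_not_dvd hdvd, mul_zero, zero_add] at hne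
      by_contra hlt'
      apply hne
      apply padicValNat.eq_zero_of_not_dvd
      rw [hp.out.dvd_factorial]
      omega
    have hx2 : x i = 2 := by
      by_contra hx2
      have : 3 * (r + 5) ≤ x i * u i := Nat.mul_le_mul (by omega) hfac
      omega
    rw [hx2] at hterm
    have hu5 : u i = r + 5 := by omega
    obtain ⟨e1, e2⟩ := sum_eq_single_of_mul_le (fun j hj => (hx j hj).1) hi
      (show _ ≤ x i * u i + 1 by rw [hx2]; omega)
    rw [e1, e2, hx2, hu5]
    refine ((Nat.modEq_iff_dvd' (by omega)).2 ⟨1, ?_⟩).symm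
    omega

/-- A version of `cycleVal_le` with one unit to spare. -/
theorem cycleVal_add_one_le_sub_add (hp5 : 5 ≤ p) (hx : ∀ i ∈ s, 0 < x i)
    (hlt : ∑ i ∈ s, u i < ∑ i ∈ s, x i * u i) :
    cycleVal p s x u + 1 + ∑ i ∈ s, u i ≤
      ∑ i ∈ s, x i * u i + padicValNat p (∑ i ∈ s, x i * u i - 1).factorial := by
  classical
  obtain ⟨i, hi, hiu⟩ : ∃ i ∈ s, u i < x i * u i := Finset.exists_lt_of_sum_lt hlt
  have hui : u i ≠ 0 := by intro h; simp [h] at hiu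
  have hxi : 2 ≤ x i := by
    by_contra h
    have := Nat.mul_le_mul_right (u i) (show x i ≤ 1 by omega)
    omega
  -- Detach one cycle of length x i: its contribution v_p(x i · u i) is paid for by x i · u i - u i,
  -- and what is left fits into (∑ x·u - 1)!.
  obtain ⟨t, ht⟩ : ∃ t, u i = t + 1 := ⟨u i - 1, by omega⟩
  set A := ∑ j ∈ s.erase i, x j * u j with hA
  have hM : ∑ j ∈ s, x j * u j = x i * u i + A := (Finset.add_sum_erase s _ hi).symm
  have hD : ∑ j ∈ s, u j = u i + ∑ j ∈ s.erase i, u j := (Finset.add_sum_erase s _ hi).symm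
  have hDA : ∑ j ∈ s.erase i, u j ≤ A := Finset.sum_le_sum fun j hj =>
    Nat.le_mul_of_pos_left _ (hx j (Finset.mem_of_mem_erase hj))
  have hv : cycleVal p s x u = (u i * padicValNat p (x i) + padicValNat p (u i).factorial) +
      cycleVal p (s.erase i) x u := by
    unfold cycleVal
    rw [← Finset.add_sum_erase s _ hi]
  have hrest : cycleVal p (s.erase i) x u ≤ padicValNat p A.factorial :=
    cycleVal_le fun j hj => hx j (Finset.mem_of_mem_erase hj)
  have hpart : t * padicValNat p (x i) + padicValNat p t.factorial ≤
      padicValNat p (x i * t).factorial := by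
    rw [← padicValNat_pow_mul_factorial (by omega)]
    exact padicValNat_le_of_dvd (Nat.factorial_ne_zero _)
      (pow_mul_factorial_dvd_factorial_mul (by omega) _)
  have hsum := padicValNat_factorial_add_le (p := p) (x i * t) A
  have hmono : padicValNat p (x i * t + A).factorial ≤
      padicValNat p (∑ j ∈ s, x j * u j - 1).factorial := by
    apply padicValNat_factorial_mono
    rw [hM, ht, mul_add]
    omega
  have hfac : padicValNat p (u i).factorial = padicValNat p (u i) + padicValNat p t.factorial := by
    rw [ht, Nat.factorial_succ, padicValNat.mul (by omega) t.factorial_ne_zero]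
  have hmul : padicValNat p (x i * u i) = padicValNat p (x i) + padicValNat p (u i) :=
    padicValNat.mul (by omega) hui
  have hbd : padicValNat p (x i * u i) + 1 ≤ x i * u i - u i := by
    apply padicValNat_add_one_le_of_le hp5
    · omega
    · have := Nat.mul_le_mul_right (u i) hxi
      omega
    · positivity
  have hexp : u i * padicValNat p (x i) = t * padicValNat p (x i) + padicValNat p (x i) := by
    rw [ht]; ring
  omega

/-- Split by divisibility of x by p. If some x prime to p occurs, x ≥ 2 leaves room to lose 1.
Otherwise ∑ x·u = pM, and the congruence hypothesis gives ∑ u ≠ M, so the sharpened bound applies to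
the quotients x/p. -/
theorem cycleVal_le_padicValNat_factorial_pred (hp5 : 5 ≤ p) (hx : ∀ i ∈ s, 2 ≤ x i)
    (h0 : ¬ ∑ i ∈ s, x i * u i ≡ ∑ i ∈ s, u i [MOD (p - 1)]) :
    cycleVal p s x u ≤ padicValNat p (∑ i ∈ s, x i * u i - 1).factorial := by
  have hx0 : ∀ i ∈ s, 0 < x i := fun i hi => by have := hx i hi; omega
  set S := ∑ i ∈ s with ¬ p ∣ x i, x i * u i with hS
  set M := ∑ i ∈ s with p ∣ x i, x i / p * u i with hM
  set T := ∑ i ∈ s with ¬ p ∣ x i, u i with hT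
  set D := ∑ i ∈ s with p ∣ x i, u i with hD
  have hsum : ∑ i ∈ s, x i * u i = S + p * M := sum_mul_eq_filter p
  have hTD : ∑ i ∈ s, u i = D + T := (Finset.sum_filter_add_sum_filter_not _ _ _).symm
  have hST : 2 * T ≤ S := by
    rw [hT, hS, Finset.mul_sum]
    exact Finset.sum_le_sum fun i hi =>
      Nat.mul_le_mul_right _ (hx i (Finset.mem_of_mem_filter i hi))
  have hv := cycleVal_eq_filter (p := p) (u := u) hx0
  have hvT : ∑ i ∈ s with ¬ p ∣ x i, padicValNat p (u i).factorial ≤ padicValNat p T.factorial :=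
    sum_padicValNat_factorial_le
  have hx1 : ∀ i ∈ s.filter (fun i => p ∣ x i), 0 < x i / p := fun i hi => by
    obtain ⟨his, hd⟩ := Finset.mem_filter.1 hi
    exact Nat.div_pos (Nat.le_of_dvd (hx0 i his) hd) hp.out.pos
  have hpM : padicValNat p (p * M).factorial = M + padicValNat p M.factorial := by
    rw [padicValNat_factorial_mul, add_comm]
  rcases Nat.eq_zero_or_pos T with hT0 | hT0
  · have hS0 : S = 0 := Finset.sum_eq_zero fun i hi => by
      rw [Finset.sum_eq_zero_iff.1 hT0 i hi, mul_zero]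
    have hDM : D ≤ M := Finset.sum_le_sum fun i hi => Nat.le_mul_of_pos_left _ (hx1 i hi)
    have hne : D ≠ M := by
      intro he
      apply h0
      rw [hsum, hTD, hS0, hT0, zero_add, add_zero, he]
      refine ((Nat.modEq_iff_dvd' (Nat.le_mul_of_pos_left _ hp.out.pos)).2 ⟨M, ?_⟩).symm
      rw [Nat.sub_mul, one_mul]
    have hkey := cycleVal_add_one_le_sub_add (p := p) hp5 hx1 (u := u)
      (show D < M by omega)
    change _ + 1 + D ≤ M + padicValNat p (M - 1).factorial at hkey
    have hpM0 : 0 < p * M := Nat.mul_pos hp.out.pos (by omega)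
    have hdiv : (p * M - 1) / p = M - 1 :=
      div_eq_pred_of_add_eq_mul (c := 1) (by omega) le_rfl (by omega)
    rw [hsum, hS0, zero_add, padicValNat_factorial_eq_div, hdiv, hv]
    have h0T : padicValNat p T.factorial = 0 := by rw [hT0]; simp
    omega
  · have h1 : cycleVal p (s.filter fun i => p ∣ x i) (fun i => x i / p) u ≤
        padicValNat p M.factorial := cycleVal_le hx1
    have hDM : D ≤ M := Finset.sum_le_sum fun i hi => Nat.le_mul_of_pos_left _ (hx1 i hi)
    have h2 := padicValNat_factorial_add_le (p := p) T (p * M)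
    have h3 : padicValNat p (T + p * M).factorial ≤ padicValNat p (S + p * M - 1).factorial :=
      padicValNat_factorial_mono (by omega)
    rw [hsum, hv]
    omega

/-- Eliminating n through `hw` cancels D, leaving v + n ≤ w + v_p(T!) - T + R + 2 - (p-1)l, where w
is the valuation for the quotients x/p. As q < l, the last three terms give at most q + 2. One more
unit is saved by v_p(T!) < T if T > 0, and by R ≡ -2 mod p if T = 0. -/
theorem cycleVal_add_le (hp5 : 5 ≤ p) (hx : ∀ i ∈ s, 2 ≤ x i ∧ x i ≠ p) {R l n : ℕ}
    (hR : ∑ i ∈ s, x i * u i = R + 2)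
    (hw : ∑ i ∈ s, x i * u i = (p - 1) * l + n + ∑ i ∈ s, u i)
    (h0 : ¬ n ≡ 0 [MOD (p - 1)]) (hq : R / p < l) :
    cycleVal p s x u + n ≤ R / p + padicValNat p (R / p).factorial + 1 := by
  have hx0 : ∀ i ∈ s, 0 < x i := fun i hi => by have := (hx i hi).1; omega
  set S := ∑ i ∈ s with ¬ p ∣ x i, x i * u i with hS
  set M := ∑ i ∈ s with p ∣ x i, x i / p * u i with hM
  set T := ∑ i ∈ s with ¬ p ∣ x i, u i with hT
  set D := ∑ i ∈ s with p ∣ x i, u i with hD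
  have hsum : ∑ i ∈ s, x i * u i = S + p * M := sum_mul_eq_filter p
  have hTD : ∑ i ∈ s, u i = D + T := (Finset.sum_filter_add_sum_filter_not _ _ _).symm
  have hST : 2 * T ≤ S := by
    rw [hT, hS, Finset.mul_sum]
    exact Finset.sum_le_sum fun i hi =>
      Nat.mul_le_mul_right _ (hx i (Finset.mem_of_mem_filter i hi)).1
  have hv := cycleVal_eq_filter (p := p) (u := u) hx0
  have hvT : ∑ i ∈ s with ¬ p ∣ x i, padicValNat p (u i).factorial ≤ padicValNat p T.factorial :=
    sum_padicValNat_factorial_le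
  have hx1 : ∀ i ∈ s.filter (fun i => p ∣ x i), 2 ≤ x i / p := fun i hi => by
    obtain ⟨his, y, hy⟩ := Finset.mem_filter.1 hi
    rw [hy, Nat.mul_div_cancel_left _ hp.out.pos]
    have := hx i his
    by_contra hlt
    rcases (show y = 0 ∨ y = 1 by omega) with rfl | rfl <;> omega
  have hl : (p - 1) * (R / p + 1) ≤ (p - 1) * l := Nat.mul_le_mul_left _ hq
  have hpl : (p - 1) * l + l = p * l := by
    rw [← Nat.succ_mul, Nat.succ_eq_add_one, Nat.sub_add_cancel hp.out.one_le]
  have hpq : (p - 1) * (R / p + 1) + (R / p + 1) = p * (R / p) + p := by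
    rw [← Nat.succ_mul, Nat.succ_eq_add_one, Nat.sub_add_cancel hp.out.one_le]; ring
  have hdm := Nat.div_add_mod R p
  have hmod := Nat.mod_lt R hp.out.pos
  rcases Nat.eq_zero_or_pos T with hT0 | hT0
  · have hS0 : S = 0 := Finset.sum_eq_zero fun i hi => by
      rw [Finset.sum_eq_zero_iff.1 hT0 i hi, mul_zero]
    have hkey := cycleVal_le_padicValNat_factorial_pred (p := p) (u := u) hp5 hx1
    have hM0 : M ≠ 0 := by
      intro h; rw [hS0, h] at hsum; omega
    have hq' : R / p = M - 1 :=
      div_eq_pred_of_add_eq_mul (c := 2) (by omega) (by omega) (by omega)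
    have hpM : (p - 1) * M + M = p * M := by
      rw [← Nat.succ_mul, Nat.succ_eq_add_one, Nat.sub_add_cancel hp.out.one_le]
    have hlM : (p - 1) * M ≤ (p - 1) * l := Nat.mul_le_mul_left _ (by omega)
    -- Here q = M - 1, so w has to be bounded by v_p((M-1)!) rather than v_p(M!); this is where n ≢
    -- 0 enters.
    have h1 : ¬ M ≡ D [MOD (p - 1)] := by
      intro h
      apply h0
      have e1 : (p - 1) * l + n + D = (p - 1) * M + M := by omega
      have e2 : n + D ≡ M [MOD (p - 1)] := by
        have : (p - 1) * l + (n + D) ≡ (p - 1) * M + M [MOD (p - 1)] := by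
          rw [← e1, add_assoc]
        simpa [Nat.ModEq, Nat.mul_add_mod] using this
      have e3 : n + D ≡ 0 + D [MOD (p - 1)] := by rw [zero_add]; exact e2.trans h
      exact Nat.ModEq.add_right_cancel' D e3
    have h2 := hkey h1
    change _ ≤ padicValNat p (M - 1).factorial at h2
    have h0T : padicValNat p T.factorial = 0 := by rw [hT0]; simp
    rw [hq', hv]
    omega
  · have h1 : cycleVal p (s.filter fun i => p ∣ x i) (fun i => x i / p) u ≤
        padicValNat p M.factorial := cycleVal_le fun i hi => by have := hx1 i hi; omega
    have h2 : padicValNat p M.factorial ≤ padicValNat p (R / p).factorial := by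
      apply padicValNat_factorial_mono
      rw [Nat.le_div_iff_mul_le hp.out.pos, mul_comm]
      omega
    have h3 := padicValNat_factorial_lt_of_ne_zero p (show T ≠ 0 by omega)
    omega

end Valuation

/-! ### The prime-to-p part of a factorial and Wilson's theorem -/

section Wilson

/-- The product of the integers in `[1, n]` that are not divisible by `p`. -/
def factorialCoprimePart (p n : ℕ) : ℕ :=
  ∏ i ∈ Finset.range n, if p ∣ i + 1 then 1 else i + 1

theorem factorialCoprimePart_succ (p n : ℕ) : factorialCoprimePart p (n + 1) =
    factorialCoprimePart p n * if p ∣ n + 1 then 1 else n + 1 := by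
  rw [factorialCoprimePart, Finset.prod_range_succ, ← factorialCoprimePart]

theorem factorial_eq_mul_factorialCoprimePart (p n : ℕ) :
    n.factorial = p ^ (n / p) * (n / p).factorial * factorialCoprimePart p n := by
  induction n with
  | zero => simp [factorialCoprimePart]
  | succ n ih =>
    rw [Nat.factorial_succ, factorialCoprimePart_succ, Nat.succ_div]
    split_ifs with h
    · obtain ⟨k, hk⟩ := h
      have hn : n / p + 1 = k := by
        have h1 := Nat.succ_div (a := n) (b := p)
        rw [hk, if_pos (Dvd.intro k rfl)] at h1
        have hp0 : 0 < p := Nat.pos_of_ne_zero (by rintro rfl; simp at hk)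
        rw [Nat.mul_div_cancel_left _ hp0] at h1
        exact h1.symm
      rw [pow_succ, Nat.factorial_succ, ih, hn, hk]
      ring
    · rw [ih, add_zero]
      ring

variable {p : ℕ}

theorem isUnit_natCast_zmod_prime_pow (hp : p.Prime) {a : ℕ} (ha : a ≠ 0) (n : ℕ) :
    IsUnit (n : ZMod (p ^ a)) ↔ ¬ p ∣ n := by
  rw [ZMod.isUnit_iff_coprime, Nat.coprime_pow_right_iff (Nat.pos_of_ne_zero ha),
    Nat.coprime_comm, hp.coprime_iff_not_dvd]

/-- An odd p cannot divide both x - 1 and x + 1, so one of them is a unit. -/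
theorem eq_one_or_eq_neg_one_of_mul_self_eq_one (hp : p.Prime) (hp2 : p ≠ 2) {a : ℕ}
    (ha : a ≠ 0) {x : ZMod (p ^ a)} (hx : x * x = 1) : x = 1 ∨ x = -1 := by
  have : NeZero (p ^ a) := ⟨pow_ne_zero a hp.ne_zero⟩
  obtain ⟨n, hn⟩ : ∃ n : ℕ, (n : ZMod (p ^ a)) = x - 1 := ⟨(x - 1).val, ZMod.natCast_zmod_val _⟩
  have h : (n : ZMod (p ^ a)) * (n + 2 : ℕ) = 0 := by
    push_cast
    rw [hn]
    linear_combination hx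
  by_cases hd : p ∣ n
  · left
    have hu : IsUnit ((n + 2 : ℕ) : ZMod (p ^ a)) := by
      rw [isUnit_natCast_zmod_prime_pow hp ha, Nat.dvd_add_right hd]
      exact fun h2 => hp2 ((Nat.prime_dvd_prime_iff_eq hp Nat.prime_two).1 h2)
    rw [hu.mul_left_eq_zero, hn] at h
    exact sub_eq_zero.1 h
  · right
    rw [((isUnit_natCast_zmod_prime_pow hp ha n).2 hd).mul_right_eq_zero] at h
    push_cast at h
    rw [hn] at h
    linear_combination h

/-- Wilson's theorem modulo an odd prime power. -/
theorem prod_units_zmod_prime_pow (hp : p.Prime) (hp2 : p ≠ 2) {a : ℕ} (ha : a ≠ 0)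
    [Fintype (ZMod (p ^ a))ˣ] : ∏ u : (ZMod (p ^ a))ˣ, u = -1 := by
  classical
  have : NeZero (p ^ a) := ⟨pow_ne_zero a hp.ne_zero⟩
  have hsq : ∀ u : (ZMod (p ^ a))ˣ, u = u⁻¹ → u = 1 ∨ u = -1 := by
    intro u hu
    have h1 : u * u = 1 := by
      nth_rewrite 2 [hu]
      exact mul_inv_cancel u
    have h2 : (u : ZMod (p ^ a)) * u = 1 := by rw [← Units.val_mul, h1, Units.val_one]
    rcases eq_one_or_eq_neg_one_of_mul_self_eq_one hp hp2 ha h2 with h | h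
    · exact Or.inl (Units.ext h)
    · exact Or.inr (Units.ext (by rw [h]; simp))
  have hne : (1 : (ZMod (p ^ a))ˣ) ≠ -1 := by
    intro h
    have h1 : ((2 : ℕ) : ZMod (p ^ a)) = 0 := by
      have := congrArg Units.val h
      rw [Units.val_one, Units.val_neg, Units.val_one] at this
      push_cast
      linear_combination this
    rw [ZMod.natCast_eq_zero_iff] at h1
    exact hp2 ((Nat.prime_dvd_prime_iff_eq hp Nat.prime_two).1 ((dvd_pow_self p ha).trans h1))
  -- Pair each unit with its inverse; only 1 and -1 are self-paired.
  have h1 : ∏ u ∈ (Finset.univ.erase (1 : (ZMod (p ^ a))ˣ)).erase (-1), u = 1 := by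
    refine Finset.prod_involution (fun u _ => u⁻¹) (fun u _ => mul_inv_cancel u) ?_ ?_
      (fun u _ => inv_inv u)
    · intro u hu _ he
      simp only [Finset.mem_erase] at hu
      rcases hsq u he.symm with h | h
      · exact hu.2.1 h
      · exact hu.1 h
    · intro u hu
      simp only [Finset.mem_erase, Finset.mem_univ, and_true] at hu ⊢
      refine ⟨fun h => hu.1 ?_, fun h => hu.2 (inv_eq_one.1 h)⟩
      rw [← inv_inv u, h]
      simp
  rw [← Finset.mul_prod_erase _ _ (Finset.mem_univ 1),
    ← Finset.mul_prod_erase _ _ (Finset.mem_erase.2 ⟨hne.symm, Finset.mem_univ (-1)⟩), h1]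
  simp

theorem factorialCoprimePart_prime_pow (hp : p.Prime) (hp2 : p ≠ 2) {a : ℕ} (ha : a ≠ 0) :
    (factorialCoprimePart p (p ^ a) : ZMod (p ^ a)) = -1 := by
  classical
  have : NeZero (p ^ a) := ⟨pow_ne_zero a hp.ne_zero⟩
  set g : ℕ → ZMod (p ^ a) := fun n => if p ∣ n then 1 else (n : ZMod (p ^ a)) with hg
  have h1 : (factorialCoprimePart p (p ^ a) : ZMod (p ^ a)) =
      ∏ i ∈ Finset.range (p ^ a), g (i + 1) := by
    rw [factorialCoprimePart, Nat.cast_prod]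
    refine Finset.prod_congr rfl fun i _ => ?_
    simp only [hg]
    split_ifs <;> simp
  -- The shift of range is harmless because `g` takes the value 1 at both ends, 0 and p^a.
  have h2 : ∏ i ∈ Finset.range (p ^ a), g (i + 1) = ∏ i ∈ Finset.range (p ^ a), g i := by
    have h3 := (Finset.prod_range_succ g (p ^ a)).symm.trans (Finset.prod_range_succ' g (p ^ a))
    have h0 : g 0 = 1 := by simp [hg]
    have hpa : g (p ^ a) = 1 := by simp [hg, dvd_pow_self p ha]
    rw [h0, hpa, mul_one, mul_one] at h3
    exact h3.symm
  have h4 : ∏ i ∈ Finset.range (p ^ a), g i =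
      ∏ i ∈ Finset.range (p ^ a) with ¬ p ∣ i, (i : ZMod (p ^ a)) := by
    rw [Finset.prod_filter]
    refine Finset.prod_congr rfl fun i _ => ?_
    simp only [hg, ite_not]
  have h5 : ((∏ u : (ZMod (p ^ a))ˣ, u : (ZMod (p ^ a))ˣ) : ZMod (p ^ a)) =
      ∏ i ∈ Finset.range (p ^ a) with ¬ p ∣ i, (i : ZMod (p ^ a)) := by
    rw [Units.coe_prod]
    refine Finset.prod_bij (fun u _ => (u : ZMod (p ^ a)).val) ?_ ?_ ?_ ?_
    · intro u _
      rw [Finset.mem_filter, Finset.mem_range, ← isUnit_natCast_zmod_prime_pow hp ha,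
        ZMod.natCast_zmod_val]
      exact ⟨ZMod.val_lt _, u.isUnit⟩
    · intro u _ v _ h
      exact Units.ext (ZMod.val_injective _ h)
    · intro i hi
      rw [Finset.mem_filter, Finset.mem_range, ← isUnit_natCast_zmod_prime_pow hp ha] at hi
      refine ⟨hi.2.unit, Finset.mem_univ _, ?_⟩
      rw [IsUnit.unit_spec, ZMod.val_cast_of_lt hi.1]
    · intro u _
      rw [ZMod.natCast_zmod_val]
  rw [h1, h2, h4, ← h5, prod_units_zmod_prime_pow hp hp2 ha]
  simp

/-- Any p^a consecutive integers contribute one full set of units mod p^a, whose product is -1. -/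
theorem factorialCoprimePart_add_prime_pow (hp : p.Prime) (hp2 : p ≠ 2) {a : ℕ} (ha : a ≠ 0)
    (n : ℕ) : (p : ℤ) ^ a ∣ factorialCoprimePart p (n + p ^ a) + factorialCoprimePart p n := by
  have key : (factorialCoprimePart p (n + p ^ a) : ZMod (p ^ a)) = -factorialCoprimePart p n := by
    induction n with
    | zero =>
      rw [zero_add, factorialCoprimePart_prime_pow hp hp2 ha]
      simp [factorialCoprimePart]
    | succ n ih =>
      rw [add_right_comm, factorialCoprimePart_succ, factorialCoprimePart_succ, Nat.cast_mul, ih]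
      have : p ∣ n + p ^ a + 1 ↔ p ∣ n + 1 := by
        rw [add_right_comm, Nat.dvd_add_left (dvd_pow_self p ha)]
      simp only [this]
      split_ifs
      · simp
      · push_cast
        have h0 : (p : ZMod (p ^ a)) ^ a = 0 := by
          exact_mod_cast ZMod.natCast_self (p ^ a)
        rw [h0]
        ring
  have h : (((factorialCoprimePart p (n + p ^ a) + factorialCoprimePart p n : ℕ) : ℤ) :
      ZMod (p ^ a)) = 0 := by
    push_cast
    rw [key]
    ring
  rw [ZMod.intCast_zmod_eq_zero_iff_dvd] at h
  exact_mod_cast h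

end Wilson

/-! ### Divisibility in the localization of ℤ at p -/

section Quotient

variable {p : ℕ}

/-- `x` lies in `p ^ a ℤ_(p)`. -/
def IsLocalMultiple (p a : ℕ) (x : ℚ) : Prop :=
  ∃ r : ℚ, ¬ p ∣ r.den ∧ x = (p : ℚ) ^ a * r

theorem IsLocalMultiple.neg {a : ℕ} {x : ℚ} (h : IsLocalMultiple p a x) :
    IsLocalMultiple p a (-x) := by
  obtain ⟨r, hr, rfl⟩ := h
  exact ⟨-r, by rwa [Rat.neg_den], by ring⟩

theorem IsLocalMultiple.neg_one_pow_mul {a : ℕ} {x : ℚ} (h : IsLocalMultiple p a x) (d : ℕ) :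
    IsLocalMultiple p a ((-1) ^ d * x) := by
  rcases neg_one_pow_eq_or ℚ d with hd | hd <;> rw [hd]
  · rwa [one_mul]
  · rw [neg_one_mul]
    exact h.neg

theorem isLocalMultiple_zero (hp : p.Prime) (a : ℕ) : IsLocalMultiple p a 0 :=
  ⟨0, by simpa using hp.one_lt.ne', by simp⟩

theorem isLocalMultiple_div [hp : Fact p.Prime] {a g : ℕ} (hg : g ≠ 0) {z : ℤ}
    (h : (p : ℤ) ^ (padicValNat p g + a) ∣ z) : IsLocalMultiple p a (z / g) := by
  obtain ⟨b, hb⟩ := pow_padicValNat_dvd (p := p) (n := g)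
  have hpb : ¬ p ∣ b := by
    rintro ⟨c, rfl⟩
    apply pow_succ_padicValNat_not_dvd (p := p) hg
    exact ⟨c, by rw [pow_succ, mul_assoc]; exact hb⟩
  obtain ⟨y, rfl⟩ := h
  refine ⟨(y : ℚ) / (b : ℤ), fun h => hpb ?_, ?_⟩
  · have h2 := Rat.den_dvd y b
    rw [Rat.divInt_eq_div] at h2
    exact_mod_cast (Int.natCast_dvd_natCast.2 h).trans h2
  · have hp0 : (p : ℚ) ≠ 0 := by exact_mod_cast hp.out.ne_zero
    have hb0 : (b : ℚ) ≠ 0 := by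
      rintro h
      apply hpb
      rw [Nat.cast_eq_zero.1 h]
      exact dvd_zero p
    have hgb : (g : ℚ) = (p : ℚ) ^ padicValNat p g * b := by exact_mod_cast hb
    rw [hgb]
    push_cast
    field_simp
    ring

end Quotient

/-! ### Divisibility of the reduced factorials -/

section Coefficient

variable {ι : Type*} {p : ℕ} {s : Finset ι} {x u : ι → ℕ}

/-- The integer `∏ i ∈ s, x i ^ u i * (u i)!`. -/
def cycleProd (s : Finset ι) (x u : ι → ℕ) : ℕ :=
  ∏ i ∈ s, x i ^ u i * (u i).factorial

theorem cycleProd_ne_zero (hx : ∀ i ∈ s, 0 < x i) : cycleProd s x u ≠ 0 :=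
  Finset.prod_ne_zero_iff.2 fun i hi =>
    mul_ne_zero (pow_pos (hx i hi) _).ne' (u i).factorial_ne_zero

theorem padicValNat_cycleProd [Fact p.Prime] (hx : ∀ i ∈ s, 0 < x i) :
    padicValNat p (cycleProd s x u) = cycleVal p s x u := by
  classical
  induction s using Finset.induction_on with
  | empty => simp [cycleProd, cycleVal]
  | insert i s hi ih =>
    have h1 := fun j hj => hx j (Finset.mem_insert_of_mem hj)
    have hxi := hx i (Finset.mem_insert_self i s)
    have h2 := ih h1
    rw [cycleProd, cycleVal] at *
    rw [Finset.prod_insert hi, Finset.sum_insert hi, ← h2, padicValNat.mul,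
      padicValNat_pow_mul_factorial hxi]
    · exact mul_ne_zero (pow_pos hxi _).ne' (u i).factorial_ne_zero
    · exact cycleProd_ne_zero h1

/-- The integer `(p * k + R)! / (p ^ k * k !)`. -/
def reducedFactorial (p R k : ℕ) : ℕ :=
  p ^ (R / p) * (k + 1).ascFactorial (R / p) * factorialCoprimePart p (p * k + R)

theorem factorial_eq_mul_reducedFactorial (hp : 0 < p) (R k : ℕ) :
    (p * k + R).factorial = p ^ k * k.factorial * reducedFactorial p R k := by
  rw [factorial_eq_mul_factorialCoprimePart p, Nat.mul_add_div hp, reducedFactorial,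
    ← Nat.factorial_mul_ascFactorial, pow_add]
  ring

theorem pow_dvd_reducedFactorial [hp : Fact p.Prime] (hp5 : 5 ≤ p)
    (hx : ∀ i ∈ s, 2 ≤ x i ∧ x i ≠ p) {R l n k a : ℕ} (hR : ∑ i ∈ s, x i * u i = R + 2)
    (hw : ∑ i ∈ s, x i * u i = (p - 1) * l + n + ∑ i ∈ s, u i)
    (h0 : ¬ n ≡ 0 [MOD (p - 1)]) (h1 : ¬ n ≡ 1 [MOD (p - 1)]) (hl : 0 < l)
    (hk : k + l = p ^ (a - 1)) (ha : 0 < a) (hna : a < n) :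
    p ^ (cycleVal p s x u + a) ∣ reducedFactorial p R k := by
  refine Dvd.dvd.mul_right ?_ _
  rcases lt_or_ge (R / p) l with hq | hq
  · have h := cycleVal_add_le hp5 hx hR hw h0 hq
    have h2 : p ^ padicValNat p (R / p).factorial ∣ (k + 1).ascFactorial (R / p) :=
      pow_padicValNat_dvd.trans (Nat.factorial_dvd_ascFactorial _ _)
    refine (pow_dvd_pow p (show _ ≤ R / p + padicValNat p (R / p).factorial by omega)).trans ?_
    rw [pow_add]
    exact Nat.mul_dvd_mul_left _ h2
  · have hmod : ¬ ∑ i ∈ s, x i * u i ≡ ∑ i ∈ s, u i + 1 [MOD (p - 1)] := by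
      intro h
      apply h1
      rw [hw, add_assoc, add_comm _ 1] at h
      have h2 : n + ∑ i ∈ s, u i ≡ 1 + ∑ i ∈ s, u i [MOD (p - 1)] := by
        simpa [Nat.ModEq, Nat.mul_add_mod] using h
      exact Nat.ModEq.add_right_cancel' _ h2
    have h := cycleVal_add_one_le hp5 hx hR hmod (by omega)
    -- Since l ≤ q, the factor k + l = p^(a-1) occurs in the rising product.
    have h2 : p ^ (a - 1) ∣ (k + 1).ascFactorial (R / p) := by
      rw [← hk, Nat.ascFactorial_eq_prod_range]
      have := Finset.dvd_prod_of_mem (fun i => k + 1 + i)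
        (Finset.mem_range.2 (show l - 1 < R / p by omega))
      rwa [show k + 1 + (l - 1) = k + l by omega] at this
    refine (pow_dvd_pow p (show _ ≤ R / p + (a - 1) by omega)).trans ?_
    rw [pow_add]
    exact Nat.mul_dvd_mul_left _ h2

theorem pow_dvd_reducedFactorial_add [hp : Fact p.Prime] (hp5 : 5 ≤ p)
    (hx : ∀ i ∈ s, 2 ≤ x i ∧ x i ≠ p) {R a : ℕ} (hR : ∑ i ∈ s, x i * u i = R + 2)
    (h1 : ¬ ∑ i ∈ s, x i * u i ≡ ∑ i ∈ s, u i + 1 [MOD (p - 1)]) (ha : 0 < a) (k : ℕ) :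
    (p : ℤ) ^ (cycleVal p s x u + a) ∣
      reducedFactorial p R k + reducedFactorial p R (k + p ^ (a - 1)) := by
  have hG := factorialCoprimePart_add_prime_pow hp.out (by omega) ha.ne' (p * k + R)
  have hidx : p * (k + p ^ (a - 1)) + R = p * k + R + p ^ a := by
    obtain ⟨b, rfl⟩ : ∃ b, a = b + 1 := ⟨a - 1, by omega⟩
    simp only [add_tsub_cancel_right, pow_succ]
    ring
  unfold reducedFactorial
  rw [hidx]
  set g := factorialCoprimePart p (p * k + R)
  set g' := factorialCoprimePart p (p * k + R + p ^ a)
  rcases eq_or_ne (R / p) 0 with hq | hq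
  · have h0 := cycleVal_eq_zero hp5 hx hR hq
    rw [h0, hq]
    simpa [add_comm] using hG
  · have h := cycleVal_add_one_le hp5 hx hR h1 hq
    have hP : ((p : ℤ) ^ (a - 1)) ∣ ((k + 1).ascFactorial (R / p) : ℤ) -
        ((k + p ^ (a - 1) + 1).ascFactorial (R / p) : ℤ) := by
      have : (k + 1).ascFactorial (R / p) ≡
          (k + p ^ (a - 1) + 1).ascFactorial (R / p) [MOD p ^ (a - 1)] := by
        rw [Nat.ascFactorial_eq_prod_range, Nat.ascFactorial_eq_prod_range]
        refine Nat.ModEq.prod fun i _ => ?_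
        rw [show k + p ^ (a - 1) + 1 + i = k + 1 + i + p ^ (a - 1) by ring]
        exact (Nat.add_modEq_right).symm
      have h2 := (Nat.modEq_iff_dvd.1 this.symm)
      exact_mod_cast h2
    have e1 : (p : ℤ) ^ (cycleVal p s x u + a) ∣ (p : ℤ) ^ (R / p) *
        (((k + 1).ascFactorial (R / p) : ℤ) -
        ((k + p ^ (a - 1) + 1).ascFactorial (R / p) : ℤ)) := by
      refine (pow_dvd_pow _ (show _ ≤ R / p + (a - 1) by omega)).trans ?_
      rw [pow_add]
      exact mul_dvd_mul_left _ hP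
    have e2 : (p : ℤ) ^ (cycleVal p s x u + a) ∣ (p : ℤ) ^ (R / p) * (g' + g) := by
      refine (pow_dvd_pow _ (show _ ≤ R / p + a by omega)).trans ?_
      rw [pow_add]
      exact mul_dvd_mul_left _ hG
    -- With rising products A, A' and prime-to-p parts g, g', this is Ag + A'g' = (A - A')g + A'(g +
    -- g').
    have e3 := (e1.mul_right (g : ℤ)).add
      (e2.mul_right ((k + p ^ (a - 1) + 1).ascFactorial (R / p) : ℤ))
    simp only [Nat.cast_mul, Nat.cast_pow]
    refine e3.trans (dvd_of_eq ?_)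
    ring

end Coefficient

/-! ### Lagrange inversion -/

section LagrangeInversion

open PowerSeries

variable {R : Type*} [CommRing R] {φ ψ : PowerSeries R}

theorem derivative_pow_of_mul_eq_one (h : φ * ψ = 1) (r : ℕ) :
    d⁄dX R (ψ ^ r) = -((r : PowerSeries R) * ψ ^ (r + 1) * d⁄dX R φ) := by
  have h1 : d⁄dX R ψ = -(ψ ^ 2 * d⁄dX R φ) := by
    have h2 := congrArg (d⁄dX R) h
    rw [Derivation.leibniz, Derivation.map_one_eq_zero, smul_eq_mul, smul_eq_mul] at h2
    linear_combination ψ * h2 - d⁄dX R ψ * h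
  induction r with
  | zero => simp
  | succ r ih =>
    rw [pow_succ, Derivation.leibniz, smul_eq_mul, smul_eq_mul, ih, h1]
    push_cast
    ring

theorem natCast_mul_coeff_eq (f : PowerSeries R) (n : ℕ) :
    ((n + 1 : ℕ) : R) * coeff (n + 1) f = coeff n (d⁄dX R f) := by
  rw [coeff_derivative]
  push_cast
  ring

theorem coeff_natCast_mul (f : PowerSeries R) (r n : ℕ) :
    coeff n ((r : PowerSeries R) * f) = r * coeff n f := by
  rw [← nsmul_eq_mul, ← nsmul_eq_mul, map_nsmul]

/-- This is the residue of u'/u^(n+1) with u = Xφ: for n > 0 it is the residue of a derivative,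
hence zero. -/
theorem coeff_derivative_X_mul_mul_pow [IsDomain R] [CharZero R] (h : φ * ψ = 1) (n : ℕ) :
    coeff n (d⁄dX R (X * φ) * ψ ^ (n + 1)) = if n = 0 then 1 else 0 := by
  have hu : d⁄dX R (X * φ) = φ + X * d⁄dX R φ := by
    rw [Derivation.leibniz, derivative_X, smul_eq_mul, smul_eq_mul]
    ring
  rw [hu]
  cases n with
  | zero =>
    have h0 := congrArg (coeff 0) h
    simp at h0 ⊢
    exact h0
  | succ n =>
    rw [if_neg n.succ_ne_zero]
    have h1 : (φ + X * d⁄dX R φ) * ψ ^ (n + 1 + 1) =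
        ψ ^ (n + 1) + X * (ψ ^ (n + 2) * d⁄dX R φ) := by
      linear_combination ψ ^ (n + 1) * h
    rw [h1, map_add, coeff_succ_X_mul]
    have h2 := natCast_mul_coeff_eq (ψ ^ (n + 1)) n
    rw [derivative_pow_of_mul_eq_one h, map_neg, mul_assoc, coeff_natCast_mul] at h2
    have h3 : ((n + 1 : ℕ) : R) ≠ 0 := Nat.cast_ne_zero.2 n.succ_ne_zero
    apply mul_left_cancel₀ h3
    rw [mul_add, h2]
    ring

/-- The residue form of Lagrange inversion: the coefficients of `F` can be read off
from `F(u)`, where `u = X * φ`. -/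
theorem coeff_subst_mul_derivative_mul_pow [IsDomain R] [CharZero R] (h : φ * ψ = 1)
    (F : PowerSeries R) (n : ℕ) :
    coeff n (F.subst (X * φ) * d⁄dX R (X * φ) * ψ ^ (n + 1)) = coeff n F := by
  have hs : HasSubst (X * φ) := HasSubst.of_constantCoeff_zero' (by simp)
  have hC : ∀ r : R, (C r).subst (X * φ) = C r := fun r => subst_C r
  induction n generalizing F with
  | zero =>
    have h0 := coeff_derivative_X_mul_mul_pow h 0
    have h1 : coeff 0 (F.subst (X * φ)) = coeff 0 F := by
      conv_lhs => rw [eq_X_mul_shift_add_const F, subst_add hs, subst_mul hs, subst_X hs]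
      rw [mul_assoc, map_add, coeff_zero_X_mul, zero_add, hC, coeff_zero_C,
        coeff_zero_eq_constantCoeff_apply]
    rw [mul_assoc, coeff_zero_eq_constantCoeff_apply, map_mul,
      ← coeff_zero_eq_constantCoeff_apply, ← coeff_zero_eq_constantCoeff_apply, h1, h0, if_pos rfl,
      mul_one]
  | succ n ih =>
    have h0 := coeff_derivative_X_mul_mul_pow h (n + 1)
    have h1 : F.subst (X * φ) = X * φ * (mk fun k => coeff (k + 1) F).subst (X * φ) +
        C (constantCoeff F) := by
      conv_lhs => rw [eq_X_mul_shift_add_const F, subst_add hs, subst_mul hs, subst_X hs]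
      rw [hC]
    set G := (mk fun k => coeff (k + 1) F).subst (X * φ)
    -- Writing F = F(0) + X·G, the factor u of u·G(u) cancels one power of ψ up to X, which lowers
    -- the index to n.
    have h2 : F.subst (X * φ) * d⁄dX R (X * φ) * ψ ^ (n + 1 + 1) =
        X * (G * d⁄dX R (X * φ) * ψ ^ (n + 1)) +
          C (constantCoeff F) * (d⁄dX R (X * φ) * ψ ^ (n + 1 + 1)) := by
      rw [h1]
      linear_combination X * G * d⁄dX R (X * φ) * ψ ^ (n + 1) * h
    rw [h2, map_add, coeff_succ_X_mul, coeff_C_mul, h0, if_neg n.succ_ne_zero, mul_zero, add_zero,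
      ih]
    simp

/-- Apply the residue form to F': since F'(u)u' = φ', the coefficient is that of φ'ψ^(n+1), and
-nφ'ψ^(n+1) is the derivative of ψ^n. -/
theorem natCast_mul_coeff_of_subst_eq [IsDomain R] [CharZero R] (h : φ * ψ = 1)
    {F : PowerSeries R} (hF : F.subst (X * φ) = φ) (n : ℕ) :
    (n : R) * coeff (n + 1) F = -coeff (n + 1) (ψ ^ n) := by
  have hs : HasSubst (X * φ) := HasSubst.of_constantCoeff_zero' (by simp)
  have h1 := coeff_subst_mul_derivative_mul_pow h (d⁄dX R F) n
  rw [← derivative_subst hs, hF, ← natCast_mul_coeff_eq] at h1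
  have h2 := natCast_mul_coeff_eq (ψ ^ n) n
  rw [derivative_pow_of_mul_eq_one h, map_neg, mul_assoc, coeff_natCast_mul,
    mul_comm (ψ ^ (n + 1)), h1] at h2
  have h3 : ((n + 1 : ℕ) : R) ≠ 0 := Nat.cast_ne_zero.2 n.succ_ne_zero
  apply mul_left_cancel₀ h3
  linear_combination h2

end LagrangeInversion

/-! ### Closed formula for the coefficients of B̂ₙ/n -/

section CoefficientFormula

open PowerSeries

/-- The power series `u(t) / t`. -/
noncomputable def uSeriesDivX : PowerSeries PolyRing :=
  mk fun k => ((k + 1 : ℕ) : ℚ)⁻¹ • c k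

/-- The power series `t / u(t)`. -/
noncomputable def uSeriesDivXInv : PowerSeries PolyRing :=
  invOfUnit uSeriesDivX 1

theorem uSeries_eq : uSeries = X * uSeriesDivX := by
  ext1 k
  cases k with
  | zero => simp [uSeries]
  | succ k => simp [uSeriesDivX, uSeries, coeff_succ_X_mul]

theorem uSeriesDivX_mul_inv : uSeriesDivX * uSeriesDivXInv = 1 := by
  refine mul_invOfUnit _ _ ?_
  rw [← coeff_zero_eq_constantCoeff_apply]
  simp [uSeriesDivX, c]

theorem quotSeries_subst : quotSeries.subst (X * uSeriesDivX) = uSeriesDivX := by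
  have hs : HasSubst (X * uSeriesDivX) := HasSubst.of_constantCoeff_zero' (by simp)
  have h := congrArg (subst (X * uSeriesDivX)) quotSeries_mul_tSeries
  rw [subst_mul hs, subst_X hs, ← uSeries_eq, tSeries_subst_uSeries, uSeries_eq, mul_comm] at h
  exact mul_left_cancel₀ X_ne_zero h

theorem natCast_mul_coeff_quotSeries (n : ℕ) : (n : PolyRing) * coeff (n + 1) quotSeries =
    -coeff (n + 1) (uSeriesDivXInv ^ n) :=
  natCast_mul_coeff_of_subst_eq uSeriesDivX_mul_inv quotSeries_subst n

/-- The partial derivative with respect to `cᵢ`, applied to each coefficient. -/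
noncomputable def coeffPDeriv (i : ℕ+) (f : PowerSeries PolyRing) : PowerSeries PolyRing :=
  mk fun n => MvPolynomial.pderiv i (coeff n f)

theorem coeffPDeriv_mul (i : ℕ+) (f g : PowerSeries PolyRing) :
    coeffPDeriv i (f * g) = coeffPDeriv i f * g + f * coeffPDeriv i g := by
  ext1 n
  simp only [coeffPDeriv, coeff_mk, coeff_mul, map_add, map_sum, MvPolynomial.pderiv_mul,
    Finset.sum_add_distrib]

theorem coeffPDeriv_one (i : ℕ+) : coeffPDeriv i 1 = 0 := by
  ext1 n
  simp only [coeffPDeriv, coeff_mk, coeff_one]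
  split_ifs <;> simp

theorem coeffPDeriv_uSeriesDivX (i : ℕ+) :
    coeffPDeriv i uSeriesDivX = C (MvPolynomial.C ((i + 1 : ℕ) : ℚ)⁻¹) * X ^ (i : ℕ) := by
  ext1 n
  rw [coeff_C_mul, coeff_X_pow]
  simp only [coeffPDeriv, uSeriesDivX, coeff_mk, MvPolynomial.smul_eq_C_mul,
    MvPolynomial.pderiv_C_mul]
  have : MvPolynomial.pderiv i (c n) = if n = i then 1 else 0 := by
    unfold c
    split_ifs with h1 h2 h2
    · subst h2
      exact MvPolynomial.pderiv_X_self _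
    · refine MvPolynomial.pderiv_X_of_ne fun h => h2 ?_
      rw [← h]
      rfl
    · exact absurd (h2 ▸ i.pos) h1
    · exact MvPolynomial.pderiv_one
  rw [this]
  split_ifs with h
  · rw [h]
  · simp

theorem coeffPDeriv_uSeriesDivXInv_pow (i : ℕ+) (r : ℕ) :
    coeffPDeriv i (uSeriesDivXInv ^ r) =
      -((r : PowerSeries PolyRing) * uSeriesDivXInv ^ (r + 1) * coeffPDeriv i uSeriesDivX) := by
  have h1 : coeffPDeriv i uSeriesDivXInv = -(uSeriesDivXInv ^ 2 * coeffPDeriv i uSeriesDivX) := by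
    have h2 := congrArg (coeffPDeriv i) uSeriesDivX_mul_inv
    rw [coeffPDeriv_mul, coeffPDeriv_one] at h2
    linear_combination uSeriesDivXInv * h2 - coeffPDeriv i uSeriesDivXInv * uSeriesDivX_mul_inv
  induction r with
  | zero => simp [coeffPDeriv_one]
  | succ r ih =>
    rw [pow_succ, coeffPDeriv_mul, ih, h1]
    push_cast
    ring

theorem pderiv_coeff_uSeriesDivXInv_pow (i : ℕ+) (r n : ℕ) :
    MvPolynomial.pderiv i (coeff n (uSeriesDivXInv ^ r)) =
      MvPolynomial.C (-(r * ((i + 1 : ℕ) : ℚ)⁻¹)) *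
        if (i : ℕ) ≤ n then coeff (n - i) (uSeriesDivXInv ^ (r + 1)) else 0 := by
  have h := congrArg (coeff n) (coeffPDeriv_uSeriesDivXInv_pow i r)
  rw [coeffPDeriv, coeff_mk, coeffPDeriv_uSeriesDivX, map_neg, mul_assoc, coeff_natCast_mul,
    mul_left_comm, coeff_C_mul, coeff_mul_X_pow'] at h
  rw [h, map_neg, map_mul, map_natCast]
  ring

/-- The weight of a monomial, where `cᵢ` has weight `i`. -/
def monomialWeight (m : ℕ+ →₀ ℕ) : ℕ :=
  m.sum fun i e => (i : ℕ) * e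

/-- The integer `∏ i, (i + 1) ^ m i * (m i)!`. -/
def monomialProd (m : ℕ+ →₀ ℕ) : ℕ :=
  cycleProd m.support (fun i => (i : ℕ) + 1) m

theorem monomialWeight_add_single (m : ℕ+ →₀ ℕ) (i : ℕ+) (e : ℕ) :
    monomialWeight (m + Finsupp.single i e) = monomialWeight m + i * e := by
  rw [monomialWeight, Finsupp.sum_add_index' (by simp) (by intros; ring),
    Finsupp.sum_single_index (by simp), ← monomialWeight]

theorem monomialProd_eq {m : ℕ+ →₀ ℕ} {s : Finset ℕ+} (hs : m.support ⊆ s) :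
    monomialProd m = cycleProd s (fun i => (i : ℕ) + 1) m := by
  refine Finset.prod_subset hs fun i _ hi => ?_
  rw [Finsupp.notMem_support_iff.1 hi]
  simp

theorem monomialProd_eq_mul_erase (m : ℕ+ →₀ ℕ) (i : ℕ+) : monomialProd m =
    ((i : ℕ) + 1) ^ m i * (m i).factorial *
      cycleProd (m.support.erase i) (fun i => (i : ℕ) + 1) m := by
  classical
  rw [monomialProd_eq (Finset.subset_insert i m.support), cycleProd,
    ← Finset.mul_prod_erase _ _ (Finset.mem_insert_self i m.support), cycleProd,
    Finset.erase_insert_eq_erase]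

theorem support_add_single_erase (m : ℕ+ →₀ ℕ) (i : ℕ+) (e : ℕ) :
    (m + Finsupp.single i e).support.erase i = m.support.erase i := by
  classical
  ext j
  simp only [Finset.mem_erase, Finsupp.mem_support_iff, Finsupp.add_apply]
  refine and_congr_right fun hj => ?_
  rw [Finsupp.single_eq_of_ne hj, add_zero]

theorem cycleProd_congr {ι : Type*} {s : Finset ι} {x u v : ι → ℕ} (h : ∀ i ∈ s, u i = v i) :
    cycleProd s x u = cycleProd s x v :=
  Finset.prod_congr rfl fun i hi => by rw [h i hi]

theorem add_single_apply_of_mem_erase (m : ℕ+ →₀ ℕ) (i : ℕ+) (e : ℕ) :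
    ∀ j ∈ m.support.erase i, (m + Finsupp.single i e) j = m j := fun j hj => by
  rw [Finsupp.add_apply, Finsupp.single_eq_of_ne (Finset.ne_of_mem_erase hj), add_zero]

theorem monomialProd_add_single (m : ℕ+ →₀ ℕ) (i : ℕ+) :
    monomialProd (m + Finsupp.single i 1) = (m i + 1) * ((i : ℕ) + 1) * monomialProd m := by
  rw [monomialProd_eq_mul_erase _ i, monomialProd_eq_mul_erase m i, support_add_single_erase]
  rw [cycleProd_congr (add_single_apply_of_mem_erase m i 1), Finsupp.add_apply,
    Finsupp.single_eq_same, pow_succ, Nat.factorial_succ]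
  ring

theorem monomialProd_ne_zero (m : ℕ+ →₀ ℕ) : monomialProd m ≠ 0 :=
  cycleProd_ne_zero fun _ _ => Nat.succ_pos _

theorem coeff_zero_coeff_uSeriesDivXInv_pow (r n : ℕ) :
    MvPolynomial.coeff 0 (coeff n (uSeriesDivXInv ^ r)) = if n = 0 then 1 else 0 := by
  have h1 : PowerSeries.map MvPolynomial.constantCoeff uSeriesDivX = 1 := by
    ext1 k
    rw [coeff_map, uSeriesDivX, coeff_mk, coeff_one]
    split_ifs with hk
    · simp [hk, c]
    · rw [MvPolynomial.constantCoeff_smul, c, dif_pos (Nat.pos_of_ne_zero hk)]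
      exact (congrArg _ (MvPolynomial.constantCoeff_X ℚ _)).trans (smul_zero _)
  have h2 : PowerSeries.map MvPolynomial.constantCoeff uSeriesDivXInv = 1 := by
    have := congrArg (PowerSeries.map MvPolynomial.constantCoeff) uSeriesDivX_mul_inv
    rwa [map_mul, h1, one_mul, map_one] at this
  have h3 := congrArg (coeff n) (congrArg (· ^ r) h2)
  simp only [← map_pow, one_pow] at h3
  rw [coeff_map, coeff_one] at h3
  exact h3

/-- Induction on the degree: as ∂φ/∂cᵢ = tⁱ/(i+1), differentiating φ^(-r) removes one cᵢ, lowers the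
weight by i, raises r by 1 and produces the factor -r/(i+1). The successive r's form the rising
factorial. -/
theorem coeff_coeff_uSeriesDivXInv_pow (m : ℕ+ →₀ ℕ) (r n : ℕ) :
    MvPolynomial.coeff m (coeff n (uSeriesDivXInv ^ r)) * monomialProd m =
      if monomialWeight m = n then (-1) ^ m.degree * (r.ascFactorial m.degree : ℚ) else 0 := by
  classical
  induction hd : m.degree generalizing m r n with
  | zero =>
    obtain rfl : m = 0 := (Finsupp.degree_eq_zero_iff m).1 hd
    rw [coeff_zero_coeff_uSeriesDivXInv_pow]
    simp [monomialProd, cycleProd, monomialWeight, eq_comm]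
  | succ d ih =>
    obtain ⟨i, hi⟩ : ∃ i, m i ≠ 0 := by
      by_contra! h
      have : m = 0 := Finsupp.ext h
      rw [this] at hd
      simp at hd
    obtain ⟨m, rfl⟩ : ∃ m', m = m' + Finsupp.single i 1 :=
      ⟨m - Finsupp.single i 1, (tsub_add_cancel_of_le (by
        rw [Finsupp.single_le_iff]; omega)).symm⟩
    have hdeg : m.degree = d := by
      rw [map_add, Finsupp.degree_single] at hd
      omega
    have h := congrArg (MvPolynomial.coeff m) (pderiv_coeff_uSeriesDivXInv_pow i r n)
    rw [MvPolynomial.coeff_pderiv, MvPolynomial.coeff_C_mul] at h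
    have hi0 : ((i : ℕ) + 1 : ℚ) ≠ 0 := by positivity
    rw [monomialProd_add_single, monomialWeight_add_single, mul_one]
    push_cast at h ⊢
    have key : MvPolynomial.coeff (m + Finsupp.single i 1) (coeff n (uSeriesDivXInv ^ r)) *
        ((m i + 1) * ((i : ℕ) + 1) * monomialProd m) = -(r : ℚ) * (MvPolynomial.coeff m
          (if (i : ℕ) ≤ n then coeff (n - i) (uSeriesDivXInv ^ (r + 1)) else 0) *
            monomialProd m) := by
      have e : (MvPolynomial.coeff (m + Finsupp.single i 1) (coeff n (uSeriesDivXInv ^ r)) *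
          ((m i : ℚ) + 1)) * (((i : ℕ) + 1) * monomialProd m) = _ :=
        congrArg (· * ((((i : ℕ) + 1 : ℚ)) * monomialProd m)) h
      rw [← mul_assoc, ← mul_assoc] at e ⊢
      rw [e]
      field_simp
    rw [key]
    split_ifs with h1 h2 h2
    · rw [ih m (r + 1) (n - i) hdeg, if_pos (by omega), pow_succ, Nat.ascFactorial_succ,
        ← Nat.succ_ascFactorial]
      push_cast
      ring
    · rw [ih m (r + 1) (n - i) hdeg, if_neg (by omega), mul_zero]
    · omega
    · simp

/-- The coefficients of `B̂ₙ / n`. -/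
theorem coeff_inv_smul_bernoulliHat (m : ℕ+ →₀ ℕ) {n : ℕ} (hn : 2 ≤ n) :
    MvPolynomial.coeff m ((n : ℚ)⁻¹ • bernoulliHat n) =
      if monomialWeight m = n then
        -(-1) ^ m.degree * ((n + m.degree - 2).factorial : ℚ) / monomialProd m else 0 := by
  obtain ⟨k, rfl⟩ : ∃ k, n = k + 1 + 1 := ⟨n - 2, by omega⟩
  have h1 := congrArg (MvPolynomial.coeff m) (natCast_mul_coeff_quotSeries (k + 1))
  rw [MvPolynomial.coeff_neg, ← map_natCast MvPolynomial.C, MvPolynomial.coeff_C_mul] at h1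
  have h2 := coeff_coeff_uSeriesDivXInv_pow m (k + 1) (k + 1 + 1)
  have h3 : (monomialProd m : ℚ) ≠ 0 := Nat.cast_ne_zero.2 (monomialProd_ne_zero m)
  have h4 : ((k + 1 : ℕ) : ℚ) ≠ 0 := Nat.cast_ne_zero.2 k.succ_ne_zero
  have h5 : ((k + 1 + 1 : ℕ) : ℚ) ≠ 0 := Nat.cast_ne_zero.2 (k + 1).succ_ne_zero
  have h6 : MvPolynomial.coeff m (((k + 1 + 1 : ℕ) : ℚ)⁻¹ • bernoulliHat (k + 1 + 1)) =
      k.factorial * (((k + 1 : ℕ) : ℚ) * MvPolynomial.coeff m (coeff (k + 1 + 1) quotSeries)) := by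
    rw [bernoulliHat, MvPolynomial.coeff_smul, MvPolynomial.coeff_smul, smul_eq_mul, smul_eq_mul,
      Nat.factorial_succ, Nat.factorial_succ]
    push_cast at h5 ⊢
    field_simp
  have h7 : MvPolynomial.coeff m (((k + 1 + 1 : ℕ) : ℚ)⁻¹ • bernoulliHat (k + 1 + 1)) *
      monomialProd m = -(k.factorial * (MvPolynomial.coeff m
        (coeff (k + 1 + 1) (uSeriesDivXInv ^ (k + 1))) * monomialProd m)) := by
    rw [h6, h1]
    ring
  rw [h2] at h7
  rw [← mul_left_inj' h3, h7]
  split_ifs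
  · rw [div_mul_cancel₀ _ h3, show k + 1 + 1 + m.degree - 2 = k + m.degree by omega,
      ← Nat.factorial_mul_ascFactorial]
    push_cast
    ring
  · simp

end CoefficientFormula

/-! ### The two kinds of monomials -/

section Congruence

variable {p : ℕ} [hp : Fact p.Prime]

theorem sum_succ_mul_eq (m : ℕ+ →₀ ℕ) (i : ℕ+) :
    monomialWeight m + m.degree =
      ((i : ℕ) + 1) * m i + ∑ j ∈ m.support.erase i, ((j : ℕ) + 1) * m j := by
  classical
  rw [monomialWeight, Finsupp.sum, Finsupp.degree_apply, ← Finset.sum_add_distrib]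
  have h : ∑ j ∈ m.support, ((j : ℕ) * m j + m j) =
      ∑ j ∈ insert i m.support, ((j : ℕ) + 1) * m j := by
    rw [Finset.sum_congr rfl fun (j : ℕ+) _ => (Nat.succ_mul (j : ℕ) (m j)).symm]
    refine Finset.sum_subset (Finset.subset_insert _ _) fun j _ hj => ?_
    rw [Finsupp.notMem_support_iff.1 hj, mul_zero]
  rw [h, ← Finset.add_sum_erase _ _ (Finset.mem_insert_self i m.support),
    Finset.erase_insert_eq_erase]

theorem sum_erase_succ_mul_eq (m : ℕ+ →₀ ℕ) (i : ℕ+) :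
    ∑ j ∈ m.support.erase i, ((j : ℕ) + 1) * m j + i * m i =
      monomialWeight m + ∑ j ∈ m.support.erase i, m j := by
  classical
  have h1 := sum_succ_mul_eq m i
  have h2 : m.degree = m i + ∑ j ∈ m.support.erase i, m j := by
    have : m.degree = ∑ j ∈ insert i m.support, m j := by
      rw [Finsupp.degree_apply]
      exact Finset.sum_subset (Finset.subset_insert _ _) fun j _ hj =>
        Finsupp.notMem_support_iff.1 hj
    rw [this, ← Finset.add_sum_erase _ _ (Finset.mem_insert_self i m.support),
      Finset.erase_insert_eq_erase]
  rw [Nat.succ_mul] at h1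
  omega

/-- A weight not divisible by i forces an indeterminate other than cᵢ to occur, and it contributes
at least 2. -/
theorem exists_sum_erase_eq_add_two {m : ℕ+ →₀ ℕ} {i : ℕ+}
    (h : ¬ monomialWeight m ≡ 0 [MOD i]) :
    ∃ R, ∑ j ∈ m.support.erase i, ((j : ℕ) + 1) * m j = R + 2 := by
  have h1 := sum_erase_succ_mul_eq m i
  have h2 : 2 * ∑ j ∈ m.support.erase i, m j ≤ ∑ j ∈ m.support.erase i, ((j : ℕ) + 1) * m j := by
    rw [Finset.mul_sum]
    exact Finset.sum_le_sum fun j _ => Nat.mul_le_mul_right _ (by have := j.pos; omega)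
  have h3 : ∑ j ∈ m.support.erase i, m j ≠ 0 := by
    intro h0
    have h4 : ∑ j ∈ m.support.erase i, ((j : ℕ) + 1) * m j = 0 :=
      Finset.sum_eq_zero fun j hj => by rw [Finset.sum_eq_zero_iff.1 h0 j hj, mul_zero]
    apply h
    rw [h0, h4] at h1
    rw [show monomialWeight m = i * m i by omega, Nat.modEq_zero_iff_dvd]
    exact dvd_mul_right _ _
  exact ⟨∑ j ∈ m.support.erase i, ((j : ℕ) + 1) * m j - 2, by omega⟩

theorem coeff_inv_smul_bernoulliHat_eq {m : ℕ+ →₀ ℕ} {i : ℕ+} (hi : (i : ℕ) + 1 = p) {R : ℕ}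
    (hR : ∑ j ∈ m.support.erase i, ((j : ℕ) + 1) * m j = R + 2) {n : ℕ} (hn : 2 ≤ n)
    (hm : monomialWeight m = n) :
    MvPolynomial.coeff m ((n : ℚ)⁻¹ • bernoulliHat n) = -(-1) ^ m.degree *
      (reducedFactorial p R (m i) / cycleProd (m.support.erase i) (fun j => (j : ℕ) + 1) m) := by
  have h1 := sum_succ_mul_eq m i
  rw [coeff_inv_smul_bernoulliHat m hn, if_pos hm, monomialProd_eq_mul_erase m i, hi,
    show n + m.degree - 2 = p * m i + R by rw [hi] at h1; omega,
    factorial_eq_mul_reducedFactorial hp.out.pos]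
  have h2 : (p : ℚ) ≠ 0 := by exact_mod_cast hp.out.ne_zero
  have h3 : ((m i).factorial : ℚ) ≠ 0 := by exact_mod_cast (m i).factorial_ne_zero
  push_cast
  rw [mul_div_assoc, mul_div_mul_left]
  exact mul_ne_zero (pow_ne_zero _ h2) h3

theorem isLocalMultiple_coeff_of_lt (hp5 : 5 ≤ p) {i : ℕ+} (hi : (i : ℕ) + 1 = p) {a n : ℕ}
    (ha : 0 < a) (h0 : ¬ n ≡ 0 [MOD (p - 1)]) (h1 : ¬ n ≡ 1 [MOD (p - 1)]) (hna : a < n)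
    {m : ℕ+ →₀ ℕ} (hm : monomialWeight m = n + p ^ (a - 1) * (p - 1)) (hk : m i < p ^ (a - 1)) :
    IsLocalMultiple p a (MvPolynomial.coeff m
      (((n + p ^ (a - 1) * (p - 1) : ℕ) : ℚ)⁻¹ • bernoulliHat (n + p ^ (a - 1) * (p - 1)))) := by
  have hip : (i : ℕ) = p - 1 := by omega
  obtain ⟨R, hR⟩ := exists_sum_erase_eq_add_two (m := m) (i := i) (by
    rw [hm, hip]
    simpa [Nat.ModEq] using h0)
  rw [coeff_inv_smul_bernoulliHat_eq hi hR (by omega) hm, neg_mul]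
  have hx : ∀ j ∈ m.support.erase i, 2 ≤ (j : ℕ) + 1 ∧ (j : ℕ) + 1 ≠ p := fun j hj => by
    refine ⟨by have := j.pos; omega, fun h => Finset.ne_of_mem_erase hj (PNat.eq ?_)⟩
    omega
  have hx0 : ∀ j ∈ m.support.erase i, 0 < (j : ℕ) + 1 := fun _ _ => Nat.succ_pos _
  refine (IsLocalMultiple.neg_one_pow_mul ?_ _).neg
  have hw := sum_erase_succ_mul_eq m i
  obtain ⟨l, hl⟩ : ∃ l, m i + l = p ^ (a - 1) := ⟨p ^ (a - 1) - m i, by omega⟩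
  rw [hm, ← hl, hip, add_mul, mul_comm (p - 1) (m i), mul_comm l] at hw
  have hdvd := pow_dvd_reducedFactorial (l := l) hp5 hx hR (by omega) h0 h1 (by omega) hl ha hna
  rw [← padicValNat_cycleProd hx0] at hdvd
  exact isLocalMultiple_div (cycleProd_ne_zero hx0) (z := (reducedFactorial p R (m i) : ℕ))
    (by exact_mod_cast hdvd)

theorem isLocalMultiple_coeff_sub (hp5 : 5 ≤ p) {i : ℕ+} (hi : (i : ℕ) + 1 = p) {a n : ℕ}
    (ha : 0 < a) (hn : 2 ≤ n) (h0 : ¬ n ≡ 0 [MOD (p - 1)]) (h1 : ¬ n ≡ 1 [MOD (p - 1)])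
    {m : ℕ+ →₀ ℕ} (hm : monomialWeight m = n) :
    IsLocalMultiple p a (MvPolynomial.coeff m ((n : ℚ)⁻¹ • bernoulliHat n) -
      MvPolynomial.coeff (m + Finsupp.single i (p ^ (a - 1)))
      (((n + p ^ (a - 1) * (p - 1) : ℕ) : ℚ)⁻¹ • bernoulliHat (n + p ^ (a - 1) * (p - 1)))) := by
  have hip : (i : ℕ) = p - 1 := by omega
  obtain ⟨R, hR⟩ := exists_sum_erase_eq_add_two (m := m) (i := i) (by rwa [hm, hip])
  set m' := m + Finsupp.single i (p ^ (a - 1)) with hm'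
  have hsupp : m'.support.erase i = m.support.erase i := support_add_single_erase m i _
  have happ := add_single_apply_of_mem_erase m i (p ^ (a - 1))
  have hR' : ∑ j ∈ m'.support.erase i, ((j : ℕ) + 1) * m' j = R + 2 := by
    rw [hsupp, ← hR]
    exact Finset.sum_congr rfl fun j hj => by rw [happ j hj]
  have hw' : monomialWeight m' = n + p ^ (a - 1) * (p - 1) := by
    rw [hm', monomialWeight_add_single, hm, hip, mul_comm (p - 1)]
  have hk : m' i = m i + p ^ (a - 1) := by simp [hm']
  have hdeg : m'.degree = m.degree + p ^ (a - 1) := by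
    rw [hm', map_add, Finsupp.degree_single]
  have hodd : Odd (p ^ (a - 1)) := (hp.out.odd_of_ne_two (by omega)).pow
  rw [coeff_inv_smul_bernoulliHat_eq hi hR hn hm,
    coeff_inv_smul_bernoulliHat_eq hi hR' (by omega) hw', hsupp, cycleProd_congr happ, hk, hdeg,
    pow_add, hodd.neg_one_pow]
  have hx : ∀ j ∈ m.support.erase i, 2 ≤ (j : ℕ) + 1 ∧ (j : ℕ) + 1 ≠ p := fun j hj => by
    refine ⟨by have := j.pos; omega, fun h => Finset.ne_of_mem_erase hj (PNat.eq ?_)⟩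
    omega
  have hx0 : ∀ j ∈ m.support.erase i, 0 < (j : ℕ) + 1 := fun _ _ => Nat.succ_pos _
  have hw := sum_erase_succ_mul_eq m i
  have hmod : ¬ ∑ j ∈ m.support.erase i, ((j : ℕ) + 1) * m j ≡
      ∑ j ∈ m.support.erase i, m j + 1 [MOD (p - 1)] := by
    intro h
    apply h1
    have h2 := h.add_right ((p - 1) * m i)
    rw [← hip] at h2
    rw [hw, hm, hip] at h2
    have h3 : n + ∑ j ∈ m.support.erase i, m j ≡
        1 + ∑ j ∈ m.support.erase i, m j [MOD (p - 1)] := by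
      rw [add_comm 1]
      simpa [Nat.ModEq, Nat.add_mul_mod_self_left] using h2
    exact Nat.ModEq.add_right_cancel' _ h3
  have hdvd := pow_dvd_reducedFactorial_add hp5 hx hR hmod ha (m i)
  rw [← padicValNat_cycleProd hx0] at hdvd
  have h := ((isLocalMultiple_div (cycleProd_ne_zero hx0) hdvd).neg_one_pow_mul m.degree).neg
  convert h using 1
  push_cast
  ring

end Congruence

/-! ### Assembling the congruence -/

theorem coeff_c_pow_mul (i : ℕ+) (s : ℕ) (f : PolyRing) (m : ℕ+ →₀ ℕ) :
    MvPolynomial.coeff m (c i ^ s * f) =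
      if s ≤ m i then MvPolynomial.coeff (m - Finsupp.single i s) f else 0 := by
  have hc : c i = MvPolynomial.X i := by
    rw [c, dif_pos i.pos]
    rfl
  rw [hc, MvPolynomial.X_pow_eq_monomial, MvPolynomial.coeff_monomial_mul', one_mul]
  simp only [Finsupp.single_le_iff]

end UniversalBernoulli

theorem corollary3p1p3 (p : ℕ) (hp : p.Prime) (a n : ℕ) (ha : 0 < a) (hn : 0 < n)
    (h0 : ¬ n ≡ 0 [MOD (p - 1)]) (h1 : ¬ n ≡ 1 [MOD (p - 1)]) (hna : a < n) :
    UniversalBernoulli.CongrModPow p a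
      (UniversalBernoulli.c (p - 1) ^ p ^ (a - 1) *
        ((n : ℚ)⁻¹ • UniversalBernoulli.bernoulliHat n))
      (((n + p ^ (a - 1) * (p - 1) : ℕ) : ℚ)⁻¹ •
        UniversalBernoulli.bernoulliHat (n + p ^ (a - 1) * (p - 1))) := by
  open UniversalBernoulli in
  -- For p = 2 or 3 every n is 0 or 1 mod p-1, so the hypotheses exclude these primes.
  have hp5 : 5 ≤ p := by
    by_contra hlt
    have h2 := hp.two_le
    have h4 : p ≠ 4 := by rintro rfl; norm_num at hp
    have h3 : p = 2 ∨ p = 3 := by omega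
    rcases h3 with rfl | rfl
    · exact h0 (Nat.modEq_one)
    · rcases Nat.mod_two_eq_zero_or_one n with h | h
      · exact h0 h
      · exact h1 h
  have : Fact p.Prime := ⟨hp⟩
  obtain ⟨i, hi⟩ : ∃ i : ℕ+, (i : ℕ) = p - 1 := ⟨⟨p - 1, by omega⟩, rfl⟩
  have hi' : (i : ℕ) + 1 = p := by omega
  have hn2 : 2 ≤ n := by omega
  intro m
  change IsLocalMultiple p a _
  rw [← hi, coeff_c_pow_mul, hi]
  split_ifs with hk
  · obtain ⟨m, rfl⟩ : ∃ m', m = m' + Finsupp.single i (p ^ (a - 1)) :=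
      ⟨m - Finsupp.single i (p ^ (a - 1)),
        (tsub_add_cancel_of_le (Finsupp.single_le_iff.2 hk)).symm⟩
    rw [add_tsub_cancel_right]
    by_cases hm : monomialWeight m = n
    · exact isLocalMultiple_coeff_sub hp5 hi' ha hn2 h0 h1 hm
    · rw [coeff_inv_smul_bernoulliHat _ hn2, if_neg hm,
        coeff_inv_smul_bernoulliHat _ (by omega), if_neg, sub_zero]
      · exact isLocalMultiple_zero hp a
      · rw [monomialWeight_add_single, hi, mul_comm]
        omega
  · rw [zero_sub]
    apply IsLocalMultiple.neg
    by_cases hm : monomialWeight m = n + p ^ (a - 1) * (p - 1)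
    · exact isLocalMultiple_coeff_of_lt hp5 hi' ha h0 h1 hna hm (by omega)
    · rw [coeff_inv_smul_bernoulliHat _ (by omega), if_neg hm]
      exact isLocalMultiple_zero hp a
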